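/- Let $P$ be a Borel probability measure on $\mathbb{R}$ with bounded support, and let $\lambda \ge 0$. For $r \ge 0$ and $s \in \mathbb{R}$ put \[\psi(r) = \mathbb{E}_{x^*,z} \log \int \exp\Big(\sqrt{r}\,zx + r x x^* - \frac{r}{2}x^2\Big)\, dP(x),\] \[\widehat{\psi}(r,s) = \mathbb{E}_{z} \log \int \exp\Big(\sqrt{r}\,zx + sx - \frac{r}{2}x^2\Big)\, dP(x), \qquad \bar{\psi}(r,s) = \mathbb{E}_{x^*}\,\widehat{\psi}(r, s x^*),\] where $x^* \sim P$ and $z \sim \mathcal{N}(0,1)$ are independent. For $q \ge 0$ and $m \in \mathbb{R}$ let \[F(\lambda,q) = \psi(\lambda q) - \frac{\lambda q^2}{4}, \qquad \phi_{\mathsf{RS}}(\lambda) = \sup_{q \ge 0} F(\lambda,q), \qquad \bar{F}(\lambda,m,q) = \bar{\psi}(\lambda q, \lambda m) - \frac{\lambda m^2}{2} + \frac{\lambda q^2}{4}.\] Then the supremum defining $\phi_{\mathsf{RS}}(\lambda)$ is finite, as are $\inf_{q \ge 0} \bar{F}(\lambda,m,q)$ for every $m \in \mathbb{R}$ and the supremum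 over $m \in \mathbb{R}$ of these infima, and \[\phi_{\mathsf{RS}}(\lambda) = \sup_{m \in \mathbb{R}} \, \inf_{q \ge 0} \, \bar{F}(\lambda,m,q).\] -/

import Mathlib

open MeasureTheory ProbabilityTheory
open scoped NNReal

namespace SpikedWigner

/-- `ψ(r) = 𝔼_{x*,z} log ∫ exp(√r z x + r x x* - (r/2) x²) dP(x)`, where `x* ∼ P` and
`z ∼ N(0,1)` are independent (used for `r ≥ 0`). -/
noncomputable def psi (P : Measure ℝ) (r : ℝ) : ℝ :=
  ∫ w : ℝ × ℝ,
    Real.log (∫ x, Real.exp (√r * w.2 * x + r * x * w.1 - r / 2 * x ^ 2) ∂P)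
    ∂(P.prod (gaussianReal 0 1))

/-- The replica-symmetric potential `F(λ, q) = ψ(λ q) - λ q² / 4`. -/
noncomputable def rsPotential (P : Measure ℝ) (lam q : ℝ) : ℝ :=
  psi P (lam * q) - lam * q ^ 2 / 4

/-- The replica-symmetric formula `φ_RS(λ) = sup_{q ≥ 0} F(λ, q)`. -/
noncomputable def rsFormula (P : Measure ℝ) (lam : ℝ) : ℝ :=
  ⨆ q : ℝ≥0, rsPotential P lam q

/-- `ψ̂(r, s) = 𝔼_z log ∫ exp(√r z x + s x - (r/2) x²) dP(x)`, where `z ∼ N(0,1)`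
(used for `r ≥ 0` and real `s`). -/
noncomputable def psiHat (P : Measure ℝ) (r s : ℝ) : ℝ :=
  ∫ z, Real.log (∫ x, Real.exp (√r * z * x + s * x - r / 2 * x ^ 2) ∂P) ∂(gaussianReal 0 1)

/-- `ψ̄(r, s) = 𝔼_{x*} ψ̂(r, s x*)`, where `x* ∼ P`. -/
noncomputable def psiBar (P : Measure ℝ) (r s : ℝ) : ℝ :=
  ∫ y, psiHat P r (s * y) ∂P

/-- The two-parameter potential `F̄(λ, m, q) = ψ̄(λ q, λ m) - λ m² / 2 + λ q² / 4`. -/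
noncomputable def fBar (P : Measure ℝ) (lam m q : ℝ) : ℝ :=
  psiBar P (lam * q) (lam * m) - lam * m ^ 2 / 2 + lam * q ^ 2 / 4

end SpikedWigner

/-! Everything rests on the scalar inequality `2ψ(r) - ψ(r') ≤ ψ̄(r', r)` for `r, r' ≥ 0`
(`two_mul_psi_sub_psi_le_psiBar`). It gives `F̄(q, q') ≥ 2F(q) - F(q') ≥ 2F(q) - φ_RS`; taking the
infimum over `q'` and the supremum over `q` yields `sup inf F̄ ≥ φ_RS`. Conversely, at `q = |m|` the
quadratic terms of `F̄` and `F` agree and `psiBar_neg_le_psi` covers `m < 0`, so `inf_q F̄(m, q) ≤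
F(|m|)`.

For the scalar inequality, let `h_t = t x* + B_t` be the planted observation. Its law has density
`Z_t` (`partition`) against that of Brownian motion, its drift given the past is the posterior mean
`a_t` (`gibbsMean`), and `a_t` is a martingale. With `L = log Z`, `ψ(t) = 𝔼 L_t(h_t)` is a relative
entropy growing at rate `𝔼 a_t² / 2`.

If `r ≤ r'`, then `ψ̄(r', r)` switches the drift off after time `r`, replacing `h_{r'}` by `h_{r'} -
∫ a`. Convexity of `L` bounds the loss by `𝔼[a_{r'} ∫ a] = ∫ 𝔼 a² = 2(ψ(r') - ψ(r))`. If `r' ≤ r`,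
the noise is switched off after time `r'` instead. Gibbs' variational principle restores it together
with an extra drift `a`, at cost `½ ∫ 𝔼 a² = ψ(r) - ψ(r')`; convexity then gains twice this amount.

Stochastic calculus is avoided by using steps of length `d`: in each step the signal is replaced by
its posterior mean, with error `O(d²)` by Hoeffding's lemma. -/

namespace SpikedWigner

/-! ### Exponential growth and Gaussian integrability. -/

/-- Measurable functions of at most exponential growth. -/
def ExpGrowth (f : ℝ → ℝ) : Prop :=
  Measurable f ∧ ∃ A B : ℝ, 0 ≤ A ∧ 0 ≤ B ∧ ∀ h, |f h| ≤ A * Real.exp (B * |h|)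

namespace ExpGrowth

variable {f g : ℝ → ℝ}

lemma measurable (hf : ExpGrowth f) : Measurable f := hf.1

lemma const (c : ℝ) : ExpGrowth fun _ => c :=
  ⟨measurable_const, |c|, 0, abs_nonneg _, le_rfl, fun h => by simp⟩

lemma id : ExpGrowth fun h => h :=
  ⟨measurable_id, 1, 1, zero_le_one, zero_le_one, fun h => by
    have := Real.add_one_le_exp |h|
    rw [one_mul, one_mul]; linarith⟩

lemma add (hf : ExpGrowth f) (hg : ExpGrowth g) : ExpGrowth fun h => f h + g h := by
  obtain ⟨hfm, A, B, hA, hB, hf⟩ := hf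
  obtain ⟨hgm, A', B', hA', hB', hg⟩ := hg
  refine ⟨hfm.add hgm, A + A', B + B', by positivity, by positivity, fun h => ?_⟩
  calc |f h + g h| ≤ |f h| + |g h| := abs_add_le _ _
    _ ≤ A * Real.exp (B * |h|) + A' * Real.exp (B' * |h|) := add_le_add (hf h) (hg h)
    _ ≤ A * Real.exp ((B + B') * |h|) + A' * Real.exp ((B + B') * |h|) := by
        gcongr <;> linarith
    _ = _ := by ring

lemma mul (hf : ExpGrowth f) (hg : ExpGrowth g) : ExpGrowth fun h => f h * g h := by
  obtain ⟨hfm, A, B, hA, hB, hf⟩ := hf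
  obtain ⟨hgm, A', B', hA', hB', hg⟩ := hg
  refine ⟨hfm.mul hgm, A * A', B + B', by positivity, by positivity, fun h => ?_⟩
  calc |f h * g h| = |f h| * |g h| := abs_mul _ _
    _ ≤ (A * Real.exp (B * |h|)) * (A' * Real.exp (B' * |h|)) :=
        mul_le_mul (hf h) (hg h) (abs_nonneg _) (by positivity)
    _ = _ := by rw [add_mul, Real.exp_add]; ring

lemma const_mul (hf : ExpGrowth f) (c : ℝ) : ExpGrowth fun h => c * f h := (const c).mul hf

lemma mul_const (hf : ExpGrowth f) (c : ℝ) : ExpGrowth fun h => f h * c := hf.mul (const c)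

lemma sub (hf : ExpGrowth f) (hg : ExpGrowth g) : ExpGrowth fun h => f h - g h := by
  simpa [sub_eq_add_neg] using hf.add (hg.const_mul (-1))

lemma exp_mul (a : ℝ) : ExpGrowth fun h => Real.exp (a * h) :=
  ⟨by fun_prop, 1, |a|, zero_le_one, abs_nonneg _, fun h => by
    rw [Real.abs_exp, one_mul, ← abs_mul]
    exact Real.exp_le_exp.2 (le_abs_self _)⟩

lemma comp_affine (hf : ExpGrowth f) (a b : ℝ) : ExpGrowth fun h => f (a + b * h) := by
  obtain ⟨hfm, A, B, hA, hB, hf⟩ := hf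
  refine ⟨hfm.comp (by fun_prop), A * Real.exp (B * |a|), B * |b|, by positivity,
    by positivity, fun h => (hf _).trans ?_⟩
  rw [mul_assoc, ← Real.exp_add]
  gcongr
  have : |a + b * h| ≤ |a| + |b| * |h| := (abs_add_le _ _).trans (by rw [abs_mul])
  nlinarith

lemma comp_add (hf : ExpGrowth f) (c : ℝ) : ExpGrowth fun h => f (h + c) := by
  simpa [add_comm] using hf.comp_affine c 1

end ExpGrowth

lemma integrable_exp_mul_abs_gaussianReal (B : ℝ) (v : ℝ≥0) :
    Integrable (fun z => Real.exp (B * |z|)) (gaussianReal 0 v) :=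
  integrable_exp_mul_abs (X := fun z => z) (integrable_exp_mul_gaussianReal B)
    (integrable_exp_mul_gaussianReal (-B))

lemma ExpGrowth.integrable {f : ℝ → ℝ} (hf : ExpGrowth f) (v : ℝ≥0) :
    Integrable f (gaussianReal 0 v) := by
  obtain ⟨hfm, A, B, hA, hB, hf⟩ := hf
  exact ((integrable_exp_mul_abs_gaussianReal B v).const_mul A).mono'
    hfm.aestronglyMeasurable (ae_of_all _ hf)

lemma ExpGrowth.integrable_affine {f : ℝ → ℝ} (hf : ExpGrowth f) (a b : ℝ) :
    Integrable (fun z => f (a + b * z)) (gaussianReal 0 1) :=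
  (hf.comp_affine a b).integrable 1

/-! ### The heat semigroup and Cameron–Martin shifts. -/

/-- The Gaussian average `𝔼 f (h + √s z)`, i.e. the heat semigroup at time `s`. -/
noncomputable def gaussAvg (s : ℝ) (f : ℝ → ℝ) (h : ℝ) : ℝ :=
  ∫ z, f (h + √s * z) ∂gaussianReal 0 1

section gaussAvg

variable {f g : ℝ → ℝ} {s : ℝ}

lemma gaussAvg_eq_integral_gaussianReal (s : ℝ≥0) (hf : Measurable f) (h : ℝ) :
    gaussAvg s f h = ∫ x, f (h + x) ∂gaussianReal 0 s := by
  have : gaussianReal 0 s = (gaussianReal 0 1).map (fun z => √(s : ℝ) * z) := by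
    rw [gaussianReal_map_const_mul]
    congr 1
    · simp
    · ext; simp
  rw [this, integral_map (by fun_prop) (f := fun x => f (h + x))
    (hf.comp (measurable_const_add h)).aestronglyMeasurable]
  rfl

lemma ExpGrowth.gaussAvg (hf : ExpGrowth f) (s : ℝ) : ExpGrowth (gaussAvg s f) := by
  obtain ⟨hfm, A, B, hA, hB, hb⟩ := hf
  have hm : Measurable (SpikedWigner.gaussAvg s f) :=
    (StronglyMeasurable.integral_prod_right' (f := fun p : ℝ × ℝ => f (p.1 + √s * p.2))
      (hfm.comp (by fun_prop)).stronglyMeasurable).measurable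
  refine ⟨hm, A * ∫ z, Real.exp (B * √s * |z|) ∂gaussianReal 0 1, B, ?_, hB, fun h => ?_⟩
  · exact mul_nonneg hA (integral_nonneg fun z => by positivity)
  · have hi := ((integrable_exp_mul_abs_gaussianReal (B * √s) 1).const_mul A).mul_const
      (Real.exp (B * |h|))
    calc |SpikedWigner.gaussAvg s f h| ≤ ∫ z, |f (h + √s * z)| ∂gaussianReal 0 1 :=
          abs_integral_le_integral_abs
      _ ≤ ∫ z, A * Real.exp (B * √s * |z|) * Real.exp (B * |h|) ∂gaussianReal 0 1 := by
          refine integral_mono_of_nonneg (ae_of_all _ fun _ => abs_nonneg _) hi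
            (ae_of_all _ fun z => (hb _).trans ?_)
          simp only [mul_assoc, ← Real.exp_add]
          gcongr
          have : |h + √s * z| ≤ |h| + √s * |z| := (abs_add_le _ _).trans (by
            rw [abs_mul, abs_of_nonneg (Real.sqrt_nonneg s)])
          nlinarith
      _ = _ := by rw [integral_mul_const, integral_const_mul]

lemma gaussAvg_add (hf : ExpGrowth f) (hg : ExpGrowth g) (h : ℝ) :
    gaussAvg s (fun x => f x + g x) h = gaussAvg s f h + gaussAvg s g h :=
  integral_add (hf.integrable_affine _ _) (hg.integrable_affine _ _)

lemma gaussAvg_sub (hf : ExpGrowth f) (hg : ExpGrowth g) (h : ℝ) :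
    gaussAvg s (fun x => f x - g x) h = gaussAvg s f h - gaussAvg s g h :=
  integral_sub (hf.integrable_affine _ _) (hg.integrable_affine _ _)

lemma gaussAvg_const_mul (c h : ℝ) :
    gaussAvg s (fun x => c * f x) h = c * gaussAvg s f h :=
  integral_const_mul _ _

lemma gaussAvg_const (c h : ℝ) : gaussAvg s (fun _ => c) h = c := by
  simp [gaussAvg]

lemma gaussAvg_mono (hf : ExpGrowth f) (hg : ExpGrowth g) (hfg : ∀ x, f x ≤ g x) (h : ℝ) :
    gaussAvg s f h ≤ gaussAvg s g h :=
  integral_mono (hf.integrable_affine _ _) (hg.integrable_affine _ _) fun _ => hfg _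

lemma gaussAvg_comp_add (c h : ℝ) :
    gaussAvg s (fun x => f (x + c)) h = gaussAvg s f (h + c) := by
  simp only [gaussAvg, add_right_comm]

lemma gaussAvg_zero (h : ℝ) : gaussAvg 0 f h = f h := by simp [gaussAvg]

/-- The semigroup property of Gaussian averaging. -/
lemma gaussAvg_gaussAvg {s t : ℝ} (hs : 0 ≤ s) (ht : 0 ≤ t) (hf : ExpGrowth f) (h : ℝ) :
    gaussAvg s (gaussAvg t f) h = gaussAvg (s + t) f h := by
  lift s to ℝ≥0 using hs
  lift t to ℝ≥0 using ht
  rw [← NNReal.coe_add, gaussAvg_eq_integral_gaussianReal _ hf.measurable,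
    gaussAvg_eq_integral_gaussianReal _ (hf.gaussAvg _).measurable]
  have := gaussianReal_conv_gaussianReal (m₁ := 0) (m₂ := 0) (v₁ := s) (v₂ := t)
  rw [add_zero] at this
  rw [← this, integral_conv]
  · refine integral_congr_ae (ae_of_all _ fun x => ?_)
    simp only [gaussAvg_eq_integral_gaussianReal _ hf.measurable, add_assoc]
  · rw [this]
    simpa using (hf.comp_affine h 1).integrable (s + t)

/-- The Cameron–Martin formula for a standard Gaussian variable. -/
lemma integral_add_gaussianReal (a : ℝ) (g : ℝ → ℝ) :
    ∫ z, g (a + z) ∂gaussianReal 0 1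
      = ∫ z, Real.exp (a * z - a ^ 2 / 2) * g z ∂gaussianReal 0 1 := by
  rw [integral_gaussianReal_eq_integral_smul one_ne_zero,
    integral_gaussianReal_eq_integral_smul one_ne_zero,
    ← integral_add_left_eq_self (fun z => gaussianPDFReal 0 1 z •
      (Real.exp (a * z - a ^ 2 / 2) * g z)) a]
  refine (integral_congr_ae (ae_of_all _ fun z => ?_)).symm
  simp only [gaussianPDFReal, smul_eq_mul, ← mul_assoc]
  congr 1
  rw [mul_assoc, ← Real.exp_add]
  congr 2
  simp
  ring

/-- Cameron–Martin for a constant drift `a` acting over a time `s`: the shift `s * a` is traded for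
an exponential density. -/
lemma gaussAvg_add_mul {s : ℝ} (hs : 0 ≤ s) (a h : ℝ) :
    gaussAvg s f (h + s * a)
      = ∫ z, Real.exp (a * (√s * z) - s * a ^ 2 / 2) * f (h + √s * z) ∂gaussianReal 0 1 := by
  have h2 : √s * √s = s := Real.mul_self_sqrt hs
  have := integral_add_gaussianReal (√s * a) (fun z => f (h + √s * z))
  refine Eq.trans (integral_congr_ae (ae_of_all _ fun z => ?_))
    (this.trans (integral_congr_ae (ae_of_all _ fun z => ?_)))
  · simp only
    congr 1
    linear_combination (-a) * h2
  · simp only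
    congr 2
    linear_combination (-a ^ 2 / 2) * h2

end gaussAvg

/-! ### The scalar channel: a priori bounds. -/

/-- The Boltzmann weight `exp (h x - (t/2) x²)` of the scalar channel at field `h` and
precision `t`. -/
noncomputable def weight (t h x : ℝ) : ℝ := Real.exp (h * x - t / 2 * x ^ 2)

/-- The partition function of the scalar channel. -/
noncomputable def partition (P : Measure ℝ) (t h : ℝ) : ℝ := ∫ x, weight t h x ∂P

/-- The unnormalised first moment of the scalar channel. -/
noncomputable def firstMoment (P : Measure ℝ) (t h : ℝ) : ℝ := ∫ x, weight t h x * x ∂P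

noncomputable def logPartition (P : Measure ℝ) (t h : ℝ) : ℝ := Real.log (partition P t h)

/-- The posterior mean of the scalar channel. -/
noncomputable def gibbsMean (P : Measure ℝ) (t h : ℝ) : ℝ := firstMoment P t h / partition P t h

lemma weight_pos (t h x : ℝ) : 0 < weight t h x := Real.exp_pos _

lemma measurable_weight (t : ℝ) : Measurable fun p : ℝ × ℝ => weight t p.1 p.2 := by
  unfold weight; fun_prop

lemma abs_exponent_le {K x : ℝ} (hx : |x| ≤ K) (t h : ℝ) :
    |h * x - t / 2 * x ^ 2| ≤ K * |h| + |t| / 2 * K ^ 2 := by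
  have hx2 : x ^ 2 ≤ K ^ 2 := by rw [← sq_abs]; gcongr
  calc |h * x - t / 2 * x ^ 2| ≤ |h * x| + |t / 2 * x ^ 2| := abs_sub _ _
    _ = |x| * |h| + |t| / 2 * x ^ 2 := by
        rw [abs_mul, abs_mul, abs_div, abs_of_nonneg (sq_nonneg x), abs_two, mul_comm |h|]
    _ ≤ _ := by gcongr

lemma weight_le {K x : ℝ} (hx : |x| ≤ K) (t h : ℝ) :
    weight t h x ≤ Real.exp (K * |h| + |t| / 2 * K ^ 2) :=
  Real.exp_le_exp.2 ((le_abs_self _).trans (abs_exponent_le hx t h))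

lemma le_weight {K x : ℝ} (hx : |x| ≤ K) (t h : ℝ) :
    Real.exp (-(K * |h| + |t| / 2 * K ^ 2)) ≤ weight t h x :=
  Real.exp_le_exp.2 (neg_le_of_abs_le (abs_exponent_le hx t h))

section

variable {P : Measure ℝ} [IsProbabilityMeasure P] {K : ℝ}

lemma integrable_of_abs_le (hP : ∀ᵐ x ∂P, |x| ≤ K) {f : ℝ → ℝ} (hf : Measurable f) (C : ℝ)
    (hC : ∀ x, |x| ≤ K → |f x| ≤ C) : Integrable f P :=
  (integrable_const C).mono' hf.aestronglyMeasurable (hP.mono hC)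

lemma integrable_weight_mul (hP : ∀ᵐ x ∂P, |x| ≤ K) (t h : ℝ) {f : ℝ → ℝ}
    (hf : Measurable f) (C : ℝ) (hC : ∀ x, |x| ≤ K → |f x| ≤ C) :
    Integrable (fun x => weight t h x * f x) P := by
  refine integrable_of_abs_le hP (by unfold weight; fun_prop)
    (Real.exp (K * |h| + |t| / 2 * K ^ 2) * C) fun x hx => ?_
  rw [abs_mul, abs_of_pos (weight_pos _ _ _)]
  exact mul_le_mul (weight_le hx _ _) (hC x hx) (abs_nonneg _) (Real.exp_pos _).le

lemma integrable_weight (hP : ∀ᵐ x ∂P, |x| ≤ K) (t h : ℝ) : Integrable (weight t h) P := by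
  simpa using integrable_weight_mul hP t h (f := fun _ => 1) measurable_const 1 (by simp)

lemma integrable_weight_mul_id (hP : ∀ᵐ x ∂P, |x| ≤ K) (t h : ℝ) :
    Integrable (fun x => weight t h x * x) P :=
  integrable_weight_mul hP t h measurable_id K fun _ hx => hx

lemma partition_le (hP : ∀ᵐ x ∂P, |x| ≤ K) (t h : ℝ) :
    partition P t h ≤ Real.exp (K * |h| + |t| / 2 * K ^ 2) := by
  have := integral_mono_ae (integrable_weight hP t h) (integrable_const _)
    (hP.mono fun x hx => weight_le hx t h)
  rwa [integral_const, probReal_univ, one_smul] at this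

lemma le_partition (hP : ∀ᵐ x ∂P, |x| ≤ K) (t h : ℝ) :
    Real.exp (-(K * |h| + |t| / 2 * K ^ 2)) ≤ partition P t h := by
  have := integral_mono_ae (integrable_const _) (integrable_weight hP t h)
    (hP.mono fun x hx => le_weight hx t h)
  rwa [integral_const, probReal_univ, one_smul] at this

lemma partition_pos (hP : ∀ᵐ x ∂P, |x| ≤ K) (t h : ℝ) : 0 < partition P t h :=
  (Real.exp_pos _).trans_le (le_partition hP t h)

lemma exp_logPartition (hP : ∀ᵐ x ∂P, |x| ≤ K) (t h : ℝ) :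
    Real.exp (logPartition P t h) = partition P t h := Real.exp_log (partition_pos hP t h)

lemma abs_logPartition_le (hP : ∀ᵐ x ∂P, |x| ≤ K) (t h : ℝ) :
    |logPartition P t h| ≤ K * |h| + |t| / 2 * K ^ 2 := by
  rw [abs_le, ← Real.exp_le_exp, ← Real.exp_le_exp (x := logPartition P t h),
    exp_logPartition hP]
  exact ⟨le_partition hP t h, partition_le hP t h⟩

lemma abs_firstMoment_le (hP : ∀ᵐ x ∂P, |x| ≤ K) (t h : ℝ) :
    |firstMoment P t h| ≤ K * partition P t h := by
  rw [partition, ← integral_const_mul]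
  refine abs_integral_le_integral_abs.trans (integral_mono_ae
    (integrable_weight_mul_id hP t h).abs ((integrable_weight hP t h).const_mul K)
    (hP.mono fun x hx => ?_))
  simp only [abs_mul, abs_of_pos (weight_pos t h x)]
  nlinarith [weight_pos t h x]

lemma abs_gibbsMean_le (hP : ∀ᵐ x ∂P, |x| ≤ K) (t h : ℝ) : |gibbsMean P t h| ≤ K := by
  rw [gibbsMean, abs_div, abs_of_pos (partition_pos hP t h), div_le_iff₀ (partition_pos hP t h)]
  exact abs_firstMoment_le hP t h

lemma gibbsMean_mul_partition (hP : ∀ᵐ x ∂P, |x| ≤ K) (t h : ℝ) :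
    gibbsMean P t h * partition P t h = firstMoment P t h :=
  div_mul_cancel₀ _ (partition_pos hP t h).ne'

lemma measurable_partition (P : Measure ℝ) [IsProbabilityMeasure P] (t : ℝ) :
    Measurable (partition P t) :=
  (StronglyMeasurable.integral_prod_right' (f := fun p : ℝ × ℝ => weight t p.1 p.2)
    (measurable_weight t).stronglyMeasurable).measurable

lemma measurable_firstMoment (P : Measure ℝ) [IsProbabilityMeasure P] (t : ℝ) :
    Measurable (firstMoment P t) :=
  (StronglyMeasurable.integral_prod_right' (f := fun p : ℝ × ℝ => weight t p.1 p.2 * p.2)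
    ((measurable_weight t).mul measurable_snd).stronglyMeasurable).measurable

lemma nonneg_of_ae_abs_le (hP : ∀ᵐ x ∂P, |x| ≤ K) : 0 ≤ K := by
  obtain ⟨x, hx⟩ := hP.exists
  exact (abs_nonneg x).trans hx

lemma expGrowth_partition (hP : ∀ᵐ x ∂P, |x| ≤ K) (t : ℝ) : ExpGrowth (partition P t) :=
  ⟨measurable_partition P t, Real.exp (|t| / 2 * K ^ 2), K, (Real.exp_pos _).le,
    nonneg_of_ae_abs_le hP, fun h => by
      rw [abs_of_pos (partition_pos hP t h), ← Real.exp_add, add_comm]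
      exact partition_le hP t h⟩

lemma expGrowth_firstMoment (hP : ∀ᵐ x ∂P, |x| ≤ K) (t : ℝ) : ExpGrowth (firstMoment P t) := by
  obtain ⟨-, A, B, hA, hB, hb⟩ := (expGrowth_partition hP t).const_mul K
  have hK := nonneg_of_ae_abs_le hP
  refine ⟨measurable_firstMoment P t, A, B, hA, hB, fun h =>
    (abs_firstMoment_le hP t h).trans ((le_abs_self _).trans (hb h))⟩

lemma expGrowth_logPartition (hP : ∀ᵐ x ∂P, |x| ≤ K) (t : ℝ) :
    ExpGrowth (logPartition P t) := by
  have hK := nonneg_of_ae_abs_le hP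
  refine ⟨(measurable_partition P t).log, K + |t| / 2 * K ^ 2, 1, by positivity, zero_le_one,
    fun h => (abs_logPartition_le hP t h).trans ?_⟩
  have h1 : |h| ≤ Real.exp (1 * |h|) := by have := Real.add_one_le_exp |h|; rw [one_mul]; linarith
  have h2 : 1 ≤ Real.exp (1 * |h|) := Real.one_le_exp (by positivity)
  have h3 : 0 ≤ |t| / 2 * K ^ 2 := by positivity
  nlinarith

lemma expGrowth_gibbsMean (hP : ∀ᵐ x ∂P, |x| ≤ K) (t : ℝ) : ExpGrowth (gibbsMean P t) :=
  ⟨(measurable_firstMoment P t).div (measurable_partition P t), K, 0, nonneg_of_ae_abs_le hP,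
    le_rfl, fun h => by simpa using abs_gibbsMean_le hP t h⟩

/-! ### Bayes' rule and the planted martingales. -/

lemma measurable_weightedAvg (P : Measure ℝ) [IsProbabilityMeasure P] (t : ℝ) {F : ℝ → ℝ → ℝ}
    (hF : Measurable (Function.uncurry F)) :
    Measurable fun h => ∫ y, weight t h y * F h y ∂P :=
  (StronglyMeasurable.integral_prod_right' (f := fun p : ℝ × ℝ => weight t p.1 p.2 * F p.1 p.2)
    ((measurable_weight t).mul hF).stronglyMeasurable).measurable

lemma expGrowth_weightedAvg (hP : ∀ᵐ x ∂P, |x| ≤ K) (t : ℝ) {F : ℝ → ℝ → ℝ}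
    (hF : Measurable (Function.uncurry F)) {A B : ℝ} (hA : 0 ≤ A) (hB : 0 ≤ B)
    (hb : ∀ h y, |y| ≤ K → |F h y| ≤ A * Real.exp (B * |h|)) :
    ExpGrowth fun h => ∫ y, weight t h y * F h y ∂P := by
  refine ⟨measurable_weightedAvg P t hF, Real.exp (|t| / 2 * K ^ 2) * A, K + B, by positivity,
    add_nonneg (nonneg_of_ae_abs_le hP) hB, fun h => ?_⟩
  have := norm_integral_le_of_norm_le_const (μ := P) (f := fun y => weight t h y * F h y)
    (C := Real.exp (K * |h| + |t| / 2 * K ^ 2) * (A * Real.exp (B * |h|))) (hP.mono fun y hy => by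
      rw [Real.norm_eq_abs, abs_mul, abs_of_pos (weight_pos _ _ _)]
      exact mul_le_mul (weight_le hy _ _) (hb h y hy) (abs_nonneg _) (Real.exp_pos _).le)
  rw [Real.norm_eq_abs, probReal_univ, mul_one] at this
  refine this.trans (le_of_eq ?_)
  rw [add_mul, Real.exp_add, Real.exp_add]
  ring

/-- The Cameron–Martin density of the drift `y` over time `s` is exactly the factor that raises the
precision of the weight from `t` to `t + s`. -/
lemma weight_mul_gaussAvg (t h y : ℝ) {s : ℝ} (hs : 0 ≤ s) (f : ℝ → ℝ) :
    weight t h y * gaussAvg s f (h + s * y)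
      = ∫ z, weight (t + s) (h + √s * z) y * f (h + √s * z) ∂gaussianReal 0 1 := by
  rw [gaussAvg_add_mul hs, ← integral_const_mul]
  refine integral_congr_ae (ae_of_all _ fun z => ?_)
  simp only [weight, ← mul_assoc, ← Real.exp_add]
  congr 2
  ring

lemma integrable_weight_mul_prod (hP : ∀ᵐ x ∂P, |x| ≤ K) (t h s : ℝ)
    {F : ℝ → ℝ → ℝ} (hF : Measurable (Function.uncurry F)) {A B : ℝ} (hA : 0 ≤ A) (hB : 0 ≤ B)
    (hb : ∀ h y, |y| ≤ K → |F h y| ≤ A * Real.exp (B * |h|)) :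
    Integrable (Function.uncurry fun y z => weight t (h + √s * z) y * F (h + √s * z) y)
      (P.prod (gaussianReal 0 1)) := by
  have hG : ExpGrowth fun k => Real.exp (K * |k| + |t| / 2 * K ^ 2) * (A * Real.exp (B * |k|)) := by
    refine ⟨by fun_prop, Real.exp (|t| / 2 * K ^ 2) * A, K + B, by positivity,
      add_nonneg (nonneg_of_ae_abs_le hP) hB, fun k => ?_⟩
    rw [abs_of_nonneg (by positivity)]
    simp only [add_mul, Real.exp_add]
    exact le_of_eq (by ring)
  refine ((hG.integrable_affine h √s).comp_snd P).mono' ?_ ?_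
  · have h1 : Measurable fun p : ℝ × ℝ => (h + √s * p.2, p.1) := by fun_prop
    exact (((measurable_weight t).comp h1).mul (hF.comp h1)).aestronglyMeasurable
  · filter_upwards [Measure.quasiMeasurePreserving_fst.ae hP] with p hp
    rw [Real.norm_eq_abs, Function.uncurry, abs_mul, abs_of_pos (weight_pos _ _ _)]
    exact mul_le_mul (weight_le hp _ _) (hb _ _ hp) (abs_nonneg _) (Real.exp_pos _).le

lemma integrable_weight_mul_gaussAvg (hP : ∀ᵐ x ∂P, |x| ≤ K) (t h : ℝ) {s : ℝ} (hs : 0 ≤ s)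
    {F : ℝ → ℝ → ℝ} (hF : Measurable (Function.uncurry F)) {A B : ℝ} (hA : 0 ≤ A) (hB : 0 ≤ B)
    (hb : ∀ h y, |y| ≤ K → |F h y| ≤ A * Real.exp (B * |h|)) :
    Integrable (fun y => weight t h y * gaussAvg s (fun k => F k y) (h + s * y)) P := by
  simp_rw [weight_mul_gaussAvg t h _ hs]
  exact (integrable_weight_mul_prod hP (t + s) h s hF hA hB hb).integral_prod_left

/-- Bayes' rule for the scalar channel: averaging over the planted signal and the noise amounts to
averaging over a centred Gaussian observation, weighted by its likelihood. -/
lemma integral_weight_mul_gaussAvg (hP : ∀ᵐ x ∂P, |x| ≤ K) (t h : ℝ) {s : ℝ} (hs : 0 ≤ s)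
    {F : ℝ → ℝ → ℝ} (hF : Measurable (Function.uncurry F)) {A B : ℝ} (hA : 0 ≤ A) (hB : 0 ≤ B)
    (hb : ∀ h y, |y| ≤ K → |F h y| ≤ A * Real.exp (B * |h|)) :
    ∫ y, weight t h y * gaussAvg s (fun k => F k y) (h + s * y) ∂P
      = gaussAvg s (fun k => ∫ y, weight (t + s) k y * F k y ∂P) h := by
  simp_rw [weight_mul_gaussAvg t h _ hs]
  exact integral_integral_swap (integrable_weight_mul_prod hP (t + s) h s hF hA hB hb)

lemma integral_weight_mul_gaussAvg_left (hP : ∀ᵐ x ∂P, |x| ≤ K) (t h : ℝ) {s : ℝ} (hs : 0 ≤ s)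
    {g : ℝ → ℝ} (hg : ExpGrowth g) :
    ∫ y, weight t h y * gaussAvg s g (h + s * y) ∂P
      = gaussAvg s (fun k => partition P (t + s) k * g k) h := by
  obtain ⟨hm, A, B, hA, hB, hb⟩ := hg
  rw [integral_weight_mul_gaussAvg hP t h hs (F := fun k _ => g k) (hm.comp measurable_fst)
    hA hB fun k _ _ => hb k]
  simp_rw [integral_mul_const]
  rfl

/-- Bayes' rule with test function `1`: the likelihood ratio is a martingale under pure noise. -/
lemma gaussAvg_partition (hP : ∀ᵐ x ∂P, |x| ≤ K) (t h : ℝ) {s : ℝ} (hs : 0 ≤ s) :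
    gaussAvg s (partition P (t + s)) h = partition P t h := by
  have := integral_weight_mul_gaussAvg_left hP t h hs (ExpGrowth.const 1)
  simp only [gaussAvg_const, mul_one] at this
  exact this.symm

/-- Bayes' rule with test function `y`. After division by the partition function, this says that the
posterior mean is a martingale under the planted law. -/
lemma gaussAvg_firstMoment (hP : ∀ᵐ x ∂P, |x| ≤ K) (t h : ℝ) {s : ℝ} (hs : 0 ≤ s) :
    gaussAvg s (firstMoment P (t + s)) h = firstMoment P t h := by
  have := integral_weight_mul_gaussAvg hP t h hs (F := fun _ y => y) measurable_snd
    (nonneg_of_ae_abs_le hP) le_rfl (fun k y hy => by simpa using hy)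
  simp only [gaussAvg_const] at this
  exact this.symm

lemma gaussAvg_sub_self (s h a : ℝ) : gaussAvg s (fun k => k - h) (h + a) = a := by
  have hz : Integrable (fun z : ℝ => √s * z) (gaussianReal 0 1) := by
    simpa using ExpGrowth.id.integrable_affine 0 √s
  have : ∀ z : ℝ, h + a + √s * z - h = a + √s * z := fun z => by ring
  simp only [gaussAvg, this]
  rw [integral_add (integrable_const _) hz, integral_const_mul, integral_id_gaussianReal]
  simp

lemma gaussAvg_partition_mul_sub (hP : ∀ᵐ x ∂P, |x| ≤ K) (t h : ℝ) {s : ℝ} (hs : 0 ≤ s) :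
    gaussAvg s (fun k => partition P (t + s) k * (k - h)) h = s * firstMoment P t h := by
  rw [← integral_weight_mul_gaussAvg_left hP t h hs (ExpGrowth.id.sub (ExpGrowth.const h))]
  simp_rw [gaussAvg_sub_self]
  rw [firstMoment, ← integral_const_mul]
  congr 1 with y
  ring

/-! ### Convexity and bounded curvature of the log-partition function. -/

/-- Tangent bound from the convexity of `h ↦ logPartition P t h`. -/
lemma logPartition_add_le (hP : ∀ᵐ x ∂P, |x| ≤ K) (t h k : ℝ) :
    logPartition P t h + (k - h) * gibbsMean P t h ≤ logPartition P t k := by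
  set u := (k - h) * gibbsMean P t h with hu
  have h1 : Real.exp u * partition P t h ≤ partition P t k := by
    have hi := ((integrable_weight hP t h).const_mul (1 - u)).add
      ((integrable_weight_mul_id hP t h).const_mul (k - h))
    -- The integrand comes from `e^{(k-h)x} ≥ e^u (1 + (k-h)x - u)`; centring at the mean value `u`
    -- makes the linear correction integrate to zero.
    have h2 : ∫ x, Real.exp u * ((1 - u) * weight t h x + (k - h) * (weight t h x * x)) ∂P
        ≤ partition P t k := by
      refine integral_mono (hi.const_mul _) (integrable_weight hP t k) fun x => ?_
      have h3 : weight t k x = weight t h x * Real.exp u * Real.exp ((k - h) * x - u) := by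
        simp only [weight, ← Real.exp_add]; congr 1; ring
      have h4 := Real.add_one_le_exp ((k - h) * x - u)
      simp only
      rw [h3]
      have h5 : 0 < weight t h x * Real.exp u := mul_pos (weight_pos _ _ _) (Real.exp_pos _)
      nlinarith [mul_le_mul_of_nonneg_left h4 h5.le]
    rw [integral_const_mul, integral_add ((integrable_weight hP t h).const_mul (1 - u))
      ((integrable_weight_mul_id hP t h).const_mul (k - h)), integral_const_mul,
      integral_const_mul] at h2
    have h6 : (1 - u) * partition P t h + (k - h) * firstMoment P t h = partition P t h := by
      rw [← gibbsMean_mul_partition hP]; rw [hu]; ring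
    rw [← h6]
    exact h2
  rw [← Real.exp_le_exp, Real.exp_add, exp_logPartition hP, exp_logPartition hP, mul_comm]
  exact h1

/-- Quadratic upper bound on `h ↦ logPartition P t h`, by Hoeffding's lemma. -/
lemma logPartition_le (hP : ∀ᵐ x ∂P, |x| ≤ K) (t h k : ℝ) :
    logPartition P t k
      ≤ logPartition P t h + (k - h) * gibbsMean P t h + K ^ 2 / 2 * (k - h) ^ 2 := by
  have hint : Integrable (fun x => Real.exp (h * x - t / 2 * x ^ 2)) P := integrable_weight hP t h
  -- The Gibbs measure at field `h` lives on `[-K, K]` and has mean `gibbsMean P t h`, so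
  -- Hoeffding's lemma bounds its centred moment generating function at `k - h`.
  set μ := P.tilted fun x => h * x - t / 2 * x ^ 2 with hμ
  have : IsProbabilityMeasure μ := isProbabilityMeasure_tilted hint
  have hμP : ∀ᵐ x ∂μ, x ∈ Set.Icc (-K) K :=
    (tilted_absolutelyContinuous P _).ae_le (hP.mono fun x hx => abs_le.1 hx)
  have hmean : ∫ x, x ∂μ = gibbsMean P t h := by
    rw [hμ, integral_tilted, gibbsMean, firstMoment, ← integral_div]
    refine integral_congr_ae (ae_of_all _ fun x => ?_)
    simp only [smul_eq_mul, weight, partition]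
    ring
  have hmgf := (hasSubgaussianMGF_of_mem_Icc (X := fun x : ℝ => x) aemeasurable_id hμP).mgf_le
    (k - h)
  have hc : (((‖K - -K‖₊ / 2) ^ 2 : ℝ≥0) : ℝ) = K ^ 2 := by
    push_cast
    rw [Real.norm_eq_abs, div_pow, sq_abs]
    ring
  rw [hc, hmean, mgf, hμ, integral_tilted] at hmgf
  have hval : ∫ x, (Real.exp (h * x - t / 2 * x ^ 2) /
        ∫ x, Real.exp (h * x - t / 2 * x ^ 2) ∂P) •
        Real.exp ((k - h) * (x - gibbsMean P t h)) ∂P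
      = Real.exp (-((k - h) * gibbsMean P t h)) * partition P t k / partition P t h := by
    rw [mul_div_assoc, partition, ← integral_div, ← integral_const_mul]
    refine integral_congr_ae (ae_of_all _ fun x => ?_)
    simp only [smul_eq_mul, weight, partition]
    rw [div_mul_eq_mul_div, mul_div_assoc', ← Real.exp_add, ← Real.exp_add]
    congr 2
    ring
  rw [hval, div_le_iff₀ (partition_pos hP t h), ← exp_logPartition hP t k,
    ← exp_logPartition hP t h, ← Real.exp_add, ← Real.exp_add, Real.exp_le_exp] at hmgf
  linarith

end

/-! ### Entropy over one increment. -/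

section

variable {P : Measure ℝ} [IsProbabilityMeasure P] {K : ℝ}

/-- Gibbs' variational inequality for one Gaussian increment with a constant drift. -/
lemma gaussAvg_logPartition_le (hP : ∀ᵐ x ∂P, |x| ≤ K) (t k a : ℝ) {s : ℝ} (hs : 0 ≤ s) :
    gaussAvg s (logPartition P (t + s)) (k + s * a) ≤ logPartition P t k + s * a ^ 2 / 2 := by
  have hZ := partition_pos hP t k
  set f : ℝ → ℝ := fun x => partition P (t + s) x * Real.exp (-(a * (x - k)) + s * a ^ 2 / 2)
    with hf
  have hfg : ExpGrowth f := by
    have h1 := (ExpGrowth.exp_mul (-a)).mul_const (Real.exp (a * k + s * a ^ 2 / 2))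
    convert (expGrowth_partition hP (t + s)).mul h1 using 3 with x
    rw [← Real.exp_add]; ring_nf
  have hfavg : gaussAvg s f (k + s * a) = partition P t k := by
    rw [gaussAvg_add_mul hs, ← gaussAvg_partition hP t k hs]
    refine integral_congr_ae (ae_of_all _ fun z => ?_)
    simp only [hf]
    rw [mul_left_comm, ← Real.exp_add]
    convert mul_one _
    rw [Real.exp_eq_one_iff]
    ring
  -- This is `log u ≤ u - 1` at `u = f x / Z_t(k)`, where the tilt in `f` undoes the drift, so that
  -- `u` averages to `1` at `k + s * a`.
  have hpt : ∀ x, logPartition P (t + s) x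
      ≤ (logPartition P t k - s * a ^ 2 / 2 - 1) + (a * (x - k) + (partition P t k)⁻¹ * f x) := by
    intro x
    have hfx : 0 < f x := mul_pos (partition_pos hP _ _) (Real.exp_pos _)
    have h1 := Real.log_le_sub_one_of_pos (mul_pos (inv_pos.2 hZ) hfx)
    rw [Real.log_mul (inv_pos.2 hZ).ne' hfx.ne', Real.log_inv, hf] at h1
    simp only at h1
    rw [Real.log_mul (partition_pos hP _ _).ne' (Real.exp_pos _).ne', Real.log_exp] at h1
    simp only [logPartition, hf]
    linarith
  have hlin := (ExpGrowth.id.sub (ExpGrowth.const k)).const_mul a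
  have h2 := gaussAvg_mono (s := s) (expGrowth_logPartition hP (t + s))
    ((ExpGrowth.const _).add (hlin.add (hfg.const_mul _))) hpt (k + s * a)
  rw [gaussAvg_add (ExpGrowth.const _) (hlin.add (hfg.const_mul _)), gaussAvg_const,
    gaussAvg_add hlin (hfg.const_mul _), gaussAvg_const_mul, gaussAvg_const_mul,
    gaussAvg_sub_self, hfavg, inv_mul_cancel₀ hZ.ne'] at h2
  linarith

/-- The relative entropy gained over one increment is at least that of the mean shift. -/
lemma le_gaussAvg_partition_mul_logPartition (hP : ∀ᵐ x ∂P, |x| ≤ K) (t h : ℝ) {s : ℝ}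
    (hs : 0 ≤ s) :
    partition P t h * logPartition P t h + s * gibbsMean P t h * firstMoment P t h / 2
      ≤ gaussAvg s (fun k => partition P (t + s) k * logPartition P (t + s) k) h := by
  have hZ := partition_pos hP t h
  have hN := gibbsMean_mul_partition hP t h
  set a := gibbsMean P t h with ha
  set e : ℝ → ℝ := fun x => Real.exp (a * (x - h) - s * a ^ 2 / 2) with he
  have heg : ExpGrowth e := by
    convert (ExpGrowth.exp_mul a).mul_const (Real.exp (-(a * h) - s * a ^ 2 / 2)) using 2 with x
    rw [he, ← Real.exp_add]; ring_nf
  have heavg : gaussAvg s e h = 1 := by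
    have h1 := gaussAvg_add_mul (f := fun _ => (1 : ℝ)) hs a h
    rw [gaussAvg_const] at h1
    rw [h1]
    refine integral_congr_ae (ae_of_all _ fun z => ?_)
    simp only [he, mul_one, add_sub_cancel_left]
  -- Nonnegativity of relative entropy against the Gaussian with drift `a`: `log u ≤ u - 1` at `u =
  -- Z_t(h) e / Z_{t+s}`, multiplied by `Z_{t+s}`. The left side averages to zero.
  have hpt : ∀ x, partition P (t + s) x - partition P t h * e x
      ≤ partition P (t + s) x * logPartition P (t + s) x
        - ((logPartition P t h - s * a ^ 2 / 2) * partition P (t + s) x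
          + a * (partition P (t + s) x * (x - h))) := by
    intro x
    have hZ' := partition_pos hP (t + s) x
    have hex : 0 < e x := Real.exp_pos _
    have h1 := Real.log_le_sub_one_of_pos (div_pos (mul_pos hZ hex) hZ')
    rw [Real.log_div (mul_pos hZ hex).ne' hZ'.ne', Real.log_mul hZ.ne' hex.ne', he] at h1
    simp only at h1
    rw [Real.log_exp] at h1
    have h2 := mul_le_mul_of_nonneg_left h1 hZ'.le
    rw [mul_sub_one, mul_div_cancel₀ _ hZ'.ne'] at h2
    simp only [logPartition, he]
    linarith
  have hZg := expGrowth_partition hP (t + s)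
  have hZT := hZg.mul (expGrowth_logPartition hP (t + s))
  have hZl := (hZg.mul (ExpGrowth.id.sub (ExpGrowth.const h))).const_mul a
  have hZc := hZg.const_mul (logPartition P t h - s * a ^ 2 / 2)
  have h2 := gaussAvg_mono (s := s) (hZg.sub (heg.const_mul _)) (hZT.sub (hZc.add hZl)) hpt h
  rw [gaussAvg_sub hZg (heg.const_mul _), gaussAvg_sub hZT (hZc.add hZl), gaussAvg_add hZc hZl,
    gaussAvg_const_mul, gaussAvg_const_mul, gaussAvg_const_mul, gaussAvg_partition hP t h hs,
    gaussAvg_partition_mul_sub hP t h hs, heavg, ← hN] at h2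
  rw [← hN]
  linarith

/-- Averaging over the noise preserves the curvature bound `K ^ 2`. -/
lemma gaussAvg_logPartition_quadratic_le (hP : ∀ᵐ x ∂P, |x| ≤ K) (T s k l : ℝ) :
    gaussAvg s (logPartition P T) l ≤ gaussAvg s (logPartition P T) k
      + (l - k) * gaussAvg s (gibbsMean P T) k + K ^ 2 / 2 * (l - k) ^ 2 := by
  have hL := expGrowth_logPartition hP T
  have hG := (expGrowth_gibbsMean hP T).const_mul (l - k)
  have h1 := gaussAvg_mono (s := s) (hL.comp_add (l - k))
    ((hL.add hG).add (ExpGrowth.const (K ^ 2 / 2 * (l - k) ^ 2)))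
    (fun x => by simpa using logPartition_le hP T x (x + (l - k))) k
  rw [gaussAvg_comp_add, gaussAvg_add (hL.add hG) (ExpGrowth.const _), gaussAvg_add hL hG,
    gaussAvg_const, gaussAvg_const_mul] at h1
  simpa using h1

/-- Replacing the planted signal by its posterior mean over a short time `s` costs `O(s²)`. -/
lemma gaussAvg_partition_mul_gaussAvg_le (hP : ∀ᵐ x ∂P, |x| ≤ K) (T t h c : ℝ) {s s' : ℝ}
    (hs : 0 ≤ s) (hs' : 0 ≤ s') :
    gaussAvg s (fun k => partition P (t + s) k * gaussAvg s' (logPartition P T) (k + c)) h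
      ≤ partition P t h * (gaussAvg (s + s') (logPartition P T) (h + c + s * gibbsMean P t h)
        + 2 * K ^ 4 * s ^ 2) := by
  have hK := nonneg_of_ae_abs_le hP
  have hN := gibbsMean_mul_partition hP t h
  have haK := abs_gibbsMean_le hP t h
  set a := gibbsMean P t h with ha
  have hL := expGrowth_logPartition hP T
  rw [← integral_weight_mul_gaussAvg_left hP t h hs ((hL.gaussAvg s').comp_add c)]
  set v := gaussAvg (s + s') (logPartition P T) with hv
  set p := gaussAvg (s + s') (gibbsMean P T) (h + c + s * a)
  have heq : ∀ y, gaussAvg s (fun k => gaussAvg s' (logPartition P T) (k + c)) (h + s * y)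
      = v (h + c + s * y) := fun y => by
    rw [gaussAvg_comp_add, gaussAvg_gaussAvg hs hs' hL, add_right_comm]
  simp_rw [heq]
  have hw := integrable_weight hP t h
  have hwy := integrable_weight_mul_id hP t h
  have hvm : Measurable v := (hL.gaussAvg _).measurable
  -- The curvature `K²` meets a displacement `s (y - a)` with `|y - a| ≤ 2K`, whence `2 K⁴ s²`. The
  -- linear term vanishes in the weighted average because `a` is the posterior mean.
  have hpt : ∀ y, |y| ≤ K → v (h + c + s * y)
      ≤ v (h + c + s * a) + s * (y - a) * p + 2 * K ^ 4 * s ^ 2 := fun y hy => by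
    have h1 := gaussAvg_logPartition_quadratic_le hP T (s + s') (h + c + s * a) (h + c + s * y)
    have h2 : (y - a) ^ 2 ≤ (2 * K) ^ 2 := by
      rw [← sq_abs]
      gcongr
      exact (abs_sub _ _).trans (by linarith)
    have h3 : K ^ 2 / 2 * (h + c + s * y - (h + c + s * a)) ^ 2 ≤ 2 * K ^ 4 * s ^ 2 := by
      have : K ^ 2 / 2 * (h + c + s * y - (h + c + s * a)) ^ 2
          = K ^ 2 / 2 * s ^ 2 * (y - a) ^ 2 := by ring
      rw [this]
      calc _ ≤ K ^ 2 / 2 * s ^ 2 * (2 * K) ^ 2 := by gcongr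
        _ = _ := by ring
    have h4 : h + c + s * y - (h + c + s * a) = s * (y - a) := by ring
    rw [h4] at h1 h3
    exact h1.trans (by linarith)
  have hi : Integrable (fun y => weight t h y * v (h + c + s * y)) P := by
    obtain ⟨-, A, B, hA, hB, hb⟩ := hL.gaussAvg (s + s')
    refine integrable_weight_mul hP t h (hvm.comp (by fun_prop))
      (A * Real.exp (B * (|h + c| + s * K))) fun y hy => (hb _).trans ?_
    gcongr
    refine (abs_add_le _ _).trans ?_
    rw [abs_mul, abs_of_nonneg hs]
    gcongr
  calc ∫ y, weight t h y * v (h + c + s * y) ∂P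
      ≤ ∫ y, ((v (h + c + s * a) + 2 * K ^ 4 * s ^ 2 - s * a * p) * weight t h y
          + s * p * (weight t h y * y)) ∂P := by
        refine integral_mono_ae hi ((hw.const_mul _).add (hwy.const_mul _))
          (hP.mono fun y hy => ?_)
        have := mul_le_mul_of_nonneg_left (hpt y hy) (weight_pos t h y).le
        simp only
        linarith
    _ = (v (h + c + s * a) + 2 * K ^ 4 * s ^ 2 - s * a * p) * partition P t h
          + s * p * firstMoment P t h := by
        rw [integral_add (hw.const_mul _) (hwy.const_mul _), integral_const_mul,
          integral_const_mul]
        rfl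
    _ = _ := by rw [← hN]; ring

/-- The relative entropy gained over a short time `s` is that of the mean shift up to `O(s²)`. -/
lemma gaussAvg_partition_mul_logPartition_le (hP : ∀ᵐ x ∂P, |x| ≤ K) (t h : ℝ) {s : ℝ}
    (hs : 0 ≤ s) :
    gaussAvg s (fun k => partition P (t + s) k * logPartition P (t + s) k) h
      ≤ partition P t h * logPartition P t h + s * gibbsMean P t h * firstMoment P t h / 2
        + 2 * K ^ 4 * s ^ 2 * partition P t h := by
  -- With no noise left after the step, the signal is first frozen at its posterior mean; Gibbs'
  -- inequality is then applied with that same drift.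
  have h1 := gaussAvg_partition_mul_gaussAvg_le hP (t + s) t h 0 hs le_rfl
  have h2 := gaussAvg_logPartition_le hP t h (gibbsMean P t h) hs
  simp only [gaussAvg_zero, add_zero] at h1
  have h3 := mul_le_mul_of_nonneg_left h2 (partition_pos hP t h).le
  rw [← gibbsMean_mul_partition hP]
  linarith

/-! ### Discretised comparison of drifts. -/

/-- Discretised comparison for `n` steps of length `d` of pure noise. -/
lemma le_partition_mul_gaussAvg_logPartition_aux (hP : ∀ᵐ x ∂P, |x| ≤ K) {d : ℝ} (hd : 0 ≤ d)
    (T : ℝ) (n : ℕ) : ∀ t h c : ℝ, T = t + n * d →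
    2 * (partition P t h * logPartition P t h) + c * firstMoment P t h
        - gaussAvg (n * d) (fun k => partition P T k * logPartition P T k) h
        - n * (2 * K ^ 4 * d ^ 2) * partition P t h
      ≤ partition P t h * gaussAvg (n * d) (logPartition P T) (h + c) := by
  have hL := expGrowth_logPartition hP T
  have hZL := (expGrowth_partition hP T).mul hL
  induction n with
  | zero =>
    intro t h c hT
    have h1 := logPartition_add_le hP t h (h + c)
    have hT : T = t := by simpa using hT
    subst hT
    simp only [Nat.cast_zero, zero_mul, gaussAvg_zero, sub_zero]
    have h2 := mul_le_mul_of_nonneg_left h1 (partition_pos hP T h).le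
    rw [← gibbsMean_mul_partition hP]
    linarith
  | succ n ih =>
    intro t h c hT
    have hnd : 0 ≤ n * d := by positivity
    have hT' : T = t + d + n * d := by rw [hT]; push_cast; ring
    have hadd : ((n + 1 : ℕ) : ℝ) * d = d + n * d := by push_cast; ring
    rw [hadd]
    set a := gibbsMean P t h with ha
    have hZ' := expGrowth_partition hP (t + d)
    have hN' := expGrowth_firstMoment hP (t + d)
    have hZL' := (hZ'.mul (expGrowth_logPartition hP (t + d))).const_mul 2
    have hNc := hN'.const_mul (c - d * a)
    have hS := hZL.gaussAvg (n * d)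
    have hE := hZ'.const_mul (n * (2 * K ^ 4 * d ^ 2))
    have hR := hZ'.mul ((hL.gaussAvg (n * d)).comp_add (c - d * a))
    -- The accumulated shift becomes `c - d * a`, cancelling the mean planted drift of this step:
    -- the field `k` moves under the planted law while `k` plus the shift has no mean drift. The
    -- resulting loss `d * a * firstMoment` is recovered from twice the entropy gain in `h3`.
    have h1 := gaussAvg_mono (s := d) (((hZL'.add hNc).sub hS).sub hE) hR
      (fun k => by simpa only [add_sub_assoc] using ih (t + d) k (c - d * a) hT') h
    rw [gaussAvg_sub ((hZL'.add hNc).sub hS) hE, gaussAvg_sub (hZL'.add hNc) hS,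
      gaussAvg_add hZL' hNc, gaussAvg_const_mul, gaussAvg_const_mul, gaussAvg_const_mul,
      gaussAvg_gaussAvg hd hnd hZL, gaussAvg_partition hP t h hd,
      gaussAvg_firstMoment hP t h hd] at h1
    have h2 := gaussAvg_partition_mul_gaussAvg_le hP T t h (c - d * a) hd hnd
    rw [← ha, show h + (c - d * a) + d * a = h + c by ring] at h2
    have h3 := le_gaussAvg_partition_mul_logPartition hP t h hd
    rw [← ha] at h3
    push_cast
    linarith

/-- Supplies the measurability and growth hypotheses of Bayes' rule when the test function itself
depends on the signal. -/
lemma exists_bound_logPartition_add_mul (hP : ∀ᵐ x ∂P, |x| ≤ K) (t c : ℝ) {e : ℝ}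
    (he : 0 ≤ e) :
    Measurable (Function.uncurry fun k y : ℝ => logPartition P t (k + c + e * y)) ∧
      ∃ A B : ℝ, 0 ≤ A ∧ 0 ≤ B ∧ ∀ k y : ℝ, |y| ≤ K →
        |logPartition P t (k + c + e * y)| ≤ A * Real.exp (B * |k|) := by
  obtain ⟨hm, A, B, hA, hB, hb⟩ := expGrowth_logPartition hP t
  refine ⟨hm.comp (by fun_prop), A * Real.exp (B * (|c| + e * K)), B, by positivity, hB,
    fun k y hy => (hb _).trans ?_⟩
  rw [mul_assoc, ← Real.exp_add, ← mul_add]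
  gcongr
  calc |k + c + e * y| ≤ |k| + |c| + |e * y| :=
        (abs_add_le _ _).trans (by gcongr; exact abs_add_le _ _)
    _ = |k| + |c| + e * |y| := by rw [abs_mul, abs_of_nonneg he]
    _ ≤ |c| + e * K + |k| := by nlinarith

/-- Discretised comparison for `n` steps of length `d` of noiseless signal. -/
lemma le_integral_weight_mul_logPartition_aux (hP : ∀ᵐ x ∂P, |x| ≤ K) {d : ℝ} (hd : 0 ≤ d)
    (T : ℝ) (n : ℕ) : ∀ t h c : ℝ, T = t + n * d →
    c * firstMoment P t h
        + 2 * gaussAvg (n * d) (fun k => partition P T k * logPartition P T k) h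
        - partition P t h * logPartition P t h
        - n * (2 * K ^ 4 * d ^ 2) * partition P t h
      ≤ ∫ y, weight t h y * logPartition P t (h + c + n * d * y) ∂P := by
  have hK := nonneg_of_ae_abs_le hP
  have hL := expGrowth_logPartition hP T
  have hZL := (expGrowth_partition hP T).mul hL
  induction n with
  | zero =>
    intro t h c hT
    have h1 := logPartition_add_le hP t h (h + c)
    have hT : T = t := by simpa using hT
    subst hT
    simp only [Nat.cast_zero, zero_mul, gaussAvg_zero, sub_zero, add_zero, integral_mul_const]
    have h2 := mul_le_mul_of_nonneg_left h1 (partition_pos hP T h).le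
    rw [← gibbsMean_mul_partition hP]
    change _ ≤ partition P T h * _
    linarith
  | succ n ih =>
    intro t h c hT
    have hnd : 0 ≤ n * d := by positivity
    have hT' : T = t + d + n * d := by rw [hT]; push_cast; ring
    have hadd : ((n + 1 : ℕ) : ℝ) * d = d + n * d := by push_cast; ring
    rw [hadd]
    have hNa := gibbsMean_mul_partition hP t h
    set a := gibbsMean P t h with ha
    obtain ⟨hm, A, B, hA, hB, hb⟩ := exists_bound_logPartition_add_mul hP (t + d) (c + d * a) hnd
    have hbayes := integral_weight_mul_gaussAvg hP t h hd hm hA hB hb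
    have hZ' := expGrowth_partition hP (t + d)
    have hN' := expGrowth_firstMoment hP (t + d)
    have hZL' := hZ'.mul (expGrowth_logPartition hP (t + d))
    have hNc := hN'.const_mul (c + d * a)
    have hS := (hZL.gaussAvg (n * d)).const_mul 2
    have hE := hZ'.const_mul (n * (2 * K ^ 4 * d ^ 2))
    -- Here the shift grows to `c + d * a`. The gain `d * a * firstMoment` pays half for the entropy
    -- of the step (`h2`) and half for removing noise and extra drift by Gibbs' inequality (`h3`).
    have h1 := gaussAvg_mono (s := d) (((hNc.add hS).sub hZL').sub hE)
      (expGrowth_weightedAvg hP (t + d) hm hA hB hb)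
      (fun k => ih (t + d) k (c + d * a) hT') h
    rw [gaussAvg_sub ((hNc.add hS).sub hZL') hE, gaussAvg_sub (hNc.add hS) hZL',
      gaussAvg_add hNc hS, gaussAvg_const_mul, gaussAvg_const_mul, gaussAvg_const_mul,
      gaussAvg_gaussAvg hd hnd hZL, gaussAvg_partition hP t h hd,
      gaussAvg_firstMoment hP t h hd, ← hbayes] at h1
    have h2 := gaussAvg_partition_mul_logPartition_le hP t h hd
    rw [← ha] at h2
    have hw := integrable_weight hP t h
    have hi2 : Integrable (fun y => weight t h y * logPartition P t (h + c + (d + n * d) * y)) P := by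
      obtain ⟨hm, A, B, hA, hB, hb⟩ := exists_bound_logPartition_add_mul hP t c (e := d + n * d) (by positivity)
      exact integrable_weight_mul hP t h (hm.comp (measurable_const.prodMk measurable_id)) _
        fun y hy => hb h y hy
    have h3 : ∫ y, weight t h y * gaussAvg d (fun k =>
          logPartition P (t + d) (k + (c + d * a) + n * d * y)) (h + d * y) ∂P
        ≤ ∫ y, (weight t h y * logPartition P t (h + c + (d + n * d) * y)
          + d * a ^ 2 / 2 * weight t h y) ∂P := by
      have hpt : ∀ y, weight t h y * gaussAvg d (fun k =>
          logPartition P (t + d) (k + (c + d * a) + n * d * y)) (h + d * y)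
          ≤ weight t h y * logPartition P t (h + c + (d + n * d) * y)
          + d * a ^ 2 / 2 * weight t h y := fun y => by
        have h4 := gaussAvg_logPartition_le hP t (h + c + (d + n * d) * y) a hd
        have h5 : gaussAvg d (fun k => logPartition P (t + d) (k + (c + d * a) + n * d * y))
            (h + d * y)
            = gaussAvg d (logPartition P (t + d)) (h + c + (d + n * d) * y + d * a) := by
          simp only [add_assoc _ (c + d * a)]
          rw [gaussAvg_comp_add]
          congr 1
          ring
        rw [h5]
        have := mul_le_mul_of_nonneg_left h4 (weight_pos t h y).le
        linarith
      exact integral_mono (integrable_weight_mul_gaussAvg hP t h hd hm hA hB hb)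
        (hi2.add (hw.const_mul _)) hpt
    rw [integral_add hi2 (hw.const_mul _), integral_const_mul] at h3
    change _ ≤ _ + d * a ^ 2 / 2 * partition P t h at h3
    push_cast
    have h6 : d * a ^ 2 / 2 * partition P t h = d * a * firstMoment P t h / 2 := by
      rw [← hNa]; ring
    rw [h6] at h3
    linarith

end

/-! ### Vanishing step length. -/

/-- Over `n` steps of length `s / n` the quadratic errors add up to `C s² Z / n`, which tends to
zero. -/
lemma le_of_forall_sub_nat_mul_sq_div_le {X Y C Z s : ℝ}
    (h : ∀ n : ℕ, 0 < n → X - n * (C * (s / n) ^ 2) * Z ≤ Y) : X ≤ Y := by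
  have h1 : Filter.Tendsto (fun n : ℕ => X - C * s ^ 2 * Z / n) Filter.atTop (nhds (X - 0)) :=
    tendsto_const_nhds.sub (tendsto_const_div_atTop_nhds_zero_nat _)
  rw [sub_zero] at h1
  refine le_of_tendsto h1 ((Filter.eventually_gt_atTop 0).mono fun n hn => ?_)
  have hn' : (n : ℝ) ≠ 0 := by positivity
  have h2 : C * s ^ 2 * Z / n = n * (C * (s / n) ^ 2) * Z := by field_simp
  rw [h2]
  exact h n hn

section

variable {P : Measure ℝ} [IsProbabilityMeasure P] {K : ℝ}

lemma le_partition_mul_gaussAvg_logPartition (hP : ∀ᵐ x ∂P, |x| ≤ K) (t h : ℝ) {s : ℝ}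
    (hs : 0 ≤ s) :
    2 * (partition P t h * logPartition P t h)
        - gaussAvg s (fun k => partition P (t + s) k * logPartition P (t + s) k) h
      ≤ partition P t h * gaussAvg s (logPartition P (t + s)) h := by
  refine le_of_forall_sub_nat_mul_sq_div_le (C := 2 * K ^ 4) (Z := partition P t h) (s := s)
    fun n hn => ?_
  have hns : (n : ℝ) * (s / n) = s := mul_div_cancel₀ _ (by positivity)
  have := le_partition_mul_gaussAvg_logPartition_aux hP (d := s / n) (by positivity) (t + s) n
    t h 0 (by rw [hns])
  simpa [hns] using this

lemma le_integral_weight_mul_logPartition (hP : ∀ᵐ x ∂P, |x| ≤ K) (t h : ℝ) {s : ℝ}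
    (hs : 0 ≤ s) :
    2 * gaussAvg s (fun k => partition P (t + s) k * logPartition P (t + s) k) h
        - partition P t h * logPartition P t h
      ≤ ∫ y, weight t h y * logPartition P t (h + s * y) ∂P := by
  refine le_of_forall_sub_nat_mul_sq_div_le (C := 2 * K ^ 4) (Z := partition P t h) (s := s)
    fun n hn => ?_
  have hns : (n : ℝ) * (s / n) = s := mul_div_cancel₀ _ (by positivity)
  have := le_integral_weight_mul_logPartition_aux hP (d := s / n) (by positivity) (t + s) n
    t h 0 (by rw [hns])
  simpa [hns] using this

/-! ### The free energies through the heat semigroup, and the scalar inequality. -/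

lemma psiHat_eq (P : Measure ℝ) (r s : ℝ) : psiHat P r s = gaussAvg r (logPartition P r) s := by
  simp only [psiHat, gaussAvg, logPartition, partition, weight]
  congr 1 with z
  congr 2 with x
  ring_nf

lemma psiBar_eq (P : Measure ℝ) (r s : ℝ) :
    psiBar P r s = ∫ y, gaussAvg r (logPartition P r) (s * y) ∂P := by
  simp only [psiBar, psiHat_eq]

lemma abs_logPartition_affine_le (hP : ∀ᵐ x ∂P, |x| ≤ K) (r s y z : ℝ) (hy : |y| ≤ K) :
    |logPartition P r (s * y + √r * z)| ≤ K * (|s| * K + √r * |z|) + |r| / 2 * K ^ 2 := by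
  have hK := nonneg_of_ae_abs_le hP
  refine (abs_logPartition_le hP r _).trans ?_
  gcongr
  refine (abs_add_le _ _).trans ?_
  rw [abs_mul, abs_mul, abs_of_nonneg (Real.sqrt_nonneg r)]
  gcongr

lemma integrable_logPartition_prod (hP : ∀ᵐ x ∂P, |x| ≤ K) (r s : ℝ) :
    Integrable (fun w : ℝ × ℝ => logPartition P r (s * w.1 + √r * w.2))
      (P.prod (gaussianReal 0 1)) := by
  have hz : Integrable (fun z : ℝ => |z|) (gaussianReal 0 1) := (ExpGrowth.id.integrable 1).abs
  have hi : Integrable (fun z : ℝ => K * (|s| * K + √r * |z|) + |r| / 2 * K ^ 2)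
      (gaussianReal 0 1) :=
    (((integrable_const _).add (hz.const_mul _)).const_mul _).add (integrable_const _)
  refine (hi.comp_snd P).mono' ?_ ?_
  · exact ((expGrowth_logPartition hP r).measurable.comp (by fun_prop)).aestronglyMeasurable
  · filter_upwards [Measure.quasiMeasurePreserving_fst.ae hP] with w hw
    exact abs_logPartition_affine_le hP r s w.1 w.2 hw

lemma integrable_gaussAvg_logPartition (hP : ∀ᵐ x ∂P, |x| ≤ K) (r s : ℝ) :
    Integrable (fun y => gaussAvg r (logPartition P r) (s * y)) P :=
  (integrable_logPartition_prod hP r s).integral_prod_left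

lemma psi_eq_psiBar (hP : ∀ᵐ x ∂P, |x| ≤ K) (r : ℝ) : psi P r = psiBar P r r := by
  have h1 : psi P r = ∫ w : ℝ × ℝ, logPartition P r (r * w.1 + √r * w.2)
      ∂(P.prod (gaussianReal 0 1)) := by
    simp only [psi, logPartition, partition, weight]
    congr 1 with w
    congr 2 with x
    ring_nf
  rw [h1, psiBar_eq, integral_prod _ (integrable_logPartition_prod hP r r)]
  rfl

lemma integral_gaussAvg_mul_left (hP : ∀ᵐ x ∂P, |x| ≤ K) {r : ℝ} (hr : 0 ≤ r) {g : ℝ → ℝ}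
    (hg : ExpGrowth g) :
    ∫ y, gaussAvg r g (r * y) ∂P = gaussAvg r (fun k => partition P r k * g k) 0 := by
  have := integral_weight_mul_gaussAvg_left hP 0 0 hr hg
  simpa [weight] using this

/-- The observation `r x* + √r z` has density `partition P r` against `N(0, r)`, so `ψ(r)` is the
relative entropy of its law. -/
lemma psi_eq_gaussAvg (hP : ∀ᵐ x ∂P, |x| ≤ K) {r : ℝ} (hr : 0 ≤ r) :
    psi P r = gaussAvg r (fun k => partition P r k * logPartition P r k) 0 := by
  rw [psi_eq_psiBar hP, psiBar_eq, integral_gaussAvg_mul_left hP hr (expGrowth_logPartition hP r)]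

/-- The scalar inequality at the heart of the minimax formula: mismatching the noise precision
costs at most as much as in the matched channel. -/
theorem two_mul_psi_sub_psi_le_psiBar (hP : ∀ᵐ x ∂P, |x| ≤ K) {r r' : ℝ} (hr : 0 ≤ r)
    (hr' : 0 ≤ r') : 2 * psi P r - psi P r' ≤ psiBar P r' r := by
  have hZL := fun r => (expGrowth_partition hP r).mul (expGrowth_logPartition hP r)
  rw [psi_eq_gaussAvg hP hr, psi_eq_gaussAvg hP hr', psiBar_eq]
  -- Both cases run the planted dynamics from `0` to time `min r r'`, then apply a pointwise
  -- comparison over the remaining `|r - r'|`: pure noise if `r ≤ r'`, noiseless signal otherwise.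
  rcases le_total r r' with h | h
  · obtain ⟨d, hd, rfl⟩ : ∃ d, 0 ≤ d ∧ r' = r + d := ⟨r' - r, sub_nonneg.2 h, by ring⟩
    have hL := expGrowth_logPartition hP (r + d)
    have h1 := gaussAvg_mono (s := r) (((hZL r).const_mul 2).sub ((hZL (r + d)).gaussAvg d))
      ((expGrowth_partition hP r).mul (hL.gaussAvg d))
      (fun k => le_partition_mul_gaussAvg_logPartition hP r k hd) 0
    rw [gaussAvg_sub ((hZL r).const_mul 2) ((hZL (r + d)).gaussAvg d), gaussAvg_const_mul,
      gaussAvg_gaussAvg hr hd (hZL (r + d)),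
      ← integral_gaussAvg_mul_left hP hr (hL.gaussAvg d)] at h1
    simpa only [gaussAvg_gaussAvg hr hd hL] using h1
  · obtain ⟨d, hd, rfl⟩ : ∃ d, 0 ≤ d ∧ r = r' + d := ⟨r - r', sub_nonneg.2 h, by ring⟩
    obtain ⟨hm, A, B, hA, hB, hb⟩ := exists_bound_logPartition_add_mul hP r' 0 hd
    have h1 := gaussAvg_mono (s := r') (((hZL (r' + d)).gaussAvg d).const_mul 2 |>.sub (hZL r'))
      (expGrowth_weightedAvg hP r' hm hA hB hb)
      (fun k => by simpa using le_integral_weight_mul_logPartition hP r' k hd) 0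
    have h2 := integral_weight_mul_gaussAvg hP 0 0 hr' hm hA hB hb
    rw [zero_add] at h2
    rw [gaussAvg_sub (((hZL (r' + d)).gaussAvg d).const_mul 2) (hZL r'), gaussAvg_const_mul,
      gaussAvg_gaussAvg hr' hd (hZL (r' + d)), ← h2] at h1
    refine h1.trans (le_of_eq ?_)
    congr 1 with y
    simp only [weight, add_zero, zero_add, zero_mul, zero_div, sub_zero, Real.exp_zero, one_mul]
    rw [gaussAvg_comp_add, add_mul]

/-! ### Sign flip and growth of the free energies. -/

lemma gaussAvg_neg (s : ℝ) (f : ℝ → ℝ) (h : ℝ) :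
    gaussAvg s f (-h) = gaussAvg s (fun k => f (-k)) h := by
  have h1 : gaussianReal 0 1 = (gaussianReal 0 1).map (MeasurableEquiv.neg ℝ) := by
    have := gaussianReal_map_neg (μ := 0) (v := 1)
    rw [neg_zero] at this
    exact this.symm
  unfold gaussAvg
  conv_lhs => rw [h1]
  rw [integral_map_equiv]
  congr 1 with z
  congr 1
  simp
  ring

lemma ExpGrowth.comp_neg {f : ℝ → ℝ} (hf : ExpGrowth f) : ExpGrowth fun h => f (-h) := by
  simpa using hf.comp_affine 0 (-1)

/-- Flipping the sign of the planted signal does not increase the free energy. -/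
lemma psiBar_neg_le_psi (hP : ∀ᵐ x ∂P, |x| ≤ K) {r : ℝ} (hr : 0 ≤ r) :
    psiBar P r (-r) ≤ psi P r := by
  have hZ := expGrowth_partition hP r
  have hL := expGrowth_logPartition hP r
  have h1 : psiBar P r (-r)
      = gaussAvg r (fun k => partition P r k * logPartition P r (-k)) 0 := by
    simp only [psiBar_eq, neg_mul, gaussAvg_neg]
    exact integral_gaussAvg_mul_left hP hr hL.comp_neg
  -- Relative entropy of the planted law with respect to its reflection; by symmetry of the Gaussian
  -- both densities have the same total mass.
  have hpt : ∀ k, partition P r k * logPartition P r (-k) - partition P r k * logPartition P r k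
      ≤ partition P r (-k) - partition P r k := fun k => by
    have hk := partition_pos hP r k
    have hk' := partition_pos hP r (-k)
    have h2 := Real.log_le_sub_one_of_pos (div_pos hk' hk)
    rw [Real.log_div hk'.ne' hk.ne'] at h2
    have h3 := mul_le_mul_of_nonneg_left h2 hk.le
    rw [mul_sub_one, mul_div_cancel₀ _ hk.ne', mul_sub] at h3
    exact h3
  have h2 := gaussAvg_mono (s := r) ((hZ.mul hL.comp_neg).sub (hZ.mul hL))
    (hZ.comp_neg.sub hZ) hpt 0
  rw [gaussAvg_sub (hZ.mul hL.comp_neg) (hZ.mul hL), gaussAvg_sub hZ.comp_neg hZ,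
    ← gaussAvg_neg, neg_zero, sub_self, ← h1, ← psi_eq_gaussAvg hP hr] at h2
  linarith

/-- Zero drift in Gibbs' inequality removes the noise and the quadratic term together, leaving the
linear bound at precision `0`. -/
lemma psi_le (hP : ∀ᵐ x ∂P, |x| ≤ K) {r : ℝ} (hr : 0 ≤ r) : psi P r ≤ r * K ^ 2 := by
  have hK := nonneg_of_ae_abs_le hP
  rw [psi_eq_psiBar hP, psiBar_eq]
  have h1 : ∀ y, |y| ≤ K → gaussAvg r (logPartition P r) (r * y) ≤ r * K ^ 2 := fun y hy => by
    have h2 := gaussAvg_logPartition_le hP 0 (r * y) 0 hr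
    have h3 := (le_abs_self _).trans (abs_logPartition_le hP 0 (r * y))
    rw [abs_mul, abs_of_nonneg hr] at h3
    simp only [zero_add, mul_zero, add_zero, abs_zero, zero_div, zero_mul, ne_eq,
      OfNat.ofNat_ne_zero, not_false_eq_true, zero_pow] at h2 h3
    have h4 : K * (r * |y|) ≤ K * (r * K) := by gcongr
    linarith
  have := integral_mono_ae (integrable_gaussAvg_logPartition hP r r) (integrable_const _)
    (hP.mono h1)
  simpa using this

/-- The tangent at field `0` averages explicitly because the noise is centred. The bound is linear
in `r`, so the term `λ q² / 4` dominates it. -/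
lemma le_psiBar (hP : ∀ᵐ x ∂P, |x| ≤ K) {r : ℝ} (hr : 0 ≤ r) (s : ℝ) :
    -(r / 2 * K ^ 2) - |s| * K ^ 2 ≤ psiBar P r s := by
  have hK := nonneg_of_ae_abs_le hP
  rw [psiBar_eq]
  have hL := expGrowth_logPartition hP r
  have ha := abs_gibbsMean_le hP r 0
  set a := gibbsMean P r 0 with hadef
  have h1 : ∀ y, |y| ≤ K →
      -(r / 2 * K ^ 2) - |s| * K ^ 2 ≤ gaussAvg r (logPartition P r) (s * y) := fun y hy => by
    have hlin := ExpGrowth.id.mul_const a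
    have h2 := gaussAvg_mono (s := r) ((ExpGrowth.const (logPartition P r 0)).add hlin) hL
      (fun k => by simpa using logPartition_add_le hP r 0 k) (s * y)
    have h3 : gaussAvg r (fun k => k * a) (s * y) = s * y * a := by
      have := gaussAvg_sub_self r 0 (s * y)
      simp only [sub_zero, zero_add] at this
      simp only [mul_comm _ a]
      rw [gaussAvg_const_mul, this]
    rw [gaussAvg_add (ExpGrowth.const _) hlin, gaussAvg_const, h3] at h2
    have h4 := neg_le_of_abs_le (abs_logPartition_le hP r 0)
    rw [abs_zero, mul_zero, zero_add, abs_of_nonneg hr] at h4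
    have h5 : |s * y * a| ≤ |s| * K * K := by
      rw [abs_mul, abs_mul]; gcongr
    have h6 := neg_le_of_abs_le h5
    linarith
  have := integral_mono_ae (integrable_const _) (integrable_gaussAvg_logPartition hP r s)
    (hP.mono h1)
  simpa using this

end

end SpikedWigner

/-! ### The minimax formula. -/

theorem proposition3 (P : Measure ℝ) [IsProbabilityMeasure P]
    (hP : ∃ K : ℝ, ∀ᵐ x ∂P, |x| ≤ K) (lam : ℝ) (hlam : 0 ≤ lam) :
    BddAbove (Set.range fun q : ℝ≥0 => SpikedWigner.rsPotential P lam q) ∧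
    (∀ m : ℝ, BddBelow (Set.range fun q : ℝ≥0 => SpikedWigner.fBar P lam m q)) ∧
    BddAbove (Set.range fun m : ℝ => ⨅ q : ℝ≥0, SpikedWigner.fBar P lam m q) ∧
    SpikedWigner.rsFormula P lam = ⨆ m : ℝ, ⨅ q : ℝ≥0, SpikedWigner.fBar P lam m q := by
  obtain ⟨K, hP⟩ := hP
  have hF : BddAbove (Set.range fun q : ℝ≥0 => SpikedWigner.rsPotential P lam q) := by
    -- Maximum of `λ (q K² - q² / 4)`, attained at `q = 2 K²`.
    refine ⟨lam * K ^ 4, ?_⟩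
    rintro _ ⟨q, rfl⟩
    have h1 := SpikedWigner.psi_le hP (mul_nonneg hlam q.coe_nonneg)
    have h2 : 0 ≤ lam * (q / 2 - K ^ 2) ^ 2 := by positivity
    simp only [SpikedWigner.rsPotential]
    linarith
  have hB : ∀ m : ℝ, BddBelow (Set.range fun q : ℝ≥0 => SpikedWigner.fBar P lam m q) := by
    intro m
    -- The first term is the minimum of `λ (q² / 4 - q K² / 2)`, attained at `q = K²`.
    refine ⟨-(lam * K ^ 4 / 4) - |lam * m| * K ^ 2 - lam * m ^ 2 / 2, ?_⟩
    rintro _ ⟨q, rfl⟩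
    have h1 := SpikedWigner.le_psiBar hP (mul_nonneg hlam q.coe_nonneg) (lam * m)
    have h2 : 0 ≤ lam * (q / 2 - K ^ 2 / 2) ^ 2 := by positivity
    simp only [SpikedWigner.fBar]
    linarith
  have hle : ∀ m : ℝ, ⨅ q : ℝ≥0, SpikedWigner.fBar P lam m q ≤ SpikedWigner.rsFormula P lam := by
    intro m
    let q : ℝ≥0 := ⟨|m|, abs_nonneg m⟩
    have hq : (q : ℝ) = |m| := rfl
    refine (ciInf_le (hB m) q).trans (le_trans ?_ (le_ciSup hF q))
    have h1 : SpikedWigner.psiBar P (lam * |m|) (lam * m) ≤ SpikedWigner.psi P (lam * |m|) := by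
      rcases abs_cases m with ⟨hm, -⟩ | ⟨hm, -⟩
      · rw [hm, SpikedWigner.psi_eq_psiBar hP]
      · have := SpikedWigner.psiBar_neg_le_psi hP (mul_nonneg hlam (abs_nonneg m))
        rwa [← mul_neg, hm, neg_neg, ← hm] at this
    simp only [SpikedWigner.fBar, SpikedWigner.rsPotential, hq, sq_abs]
    linarith
  have hS : BddAbove (Set.range fun m : ℝ => ⨅ q : ℝ≥0, SpikedWigner.fBar P lam m q) :=
    ⟨_, Set.forall_mem_range.2 hle⟩
  refine ⟨hF, hB, hS, le_antisymm ?_ (ciSup_le hle)⟩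
  set S := ⨆ m : ℝ, ⨅ q : ℝ≥0, SpikedWigner.fBar P lam m q with hSdef
  -- With `m = q`, the scalar inequality gives `F̄(q, q') ≥ 2F(q) - F(q')`. Bounding `F(q')` by its
  -- supremum makes this uniform in `q'`, and the supremum over `q` then closes the loop as `φ_RS ≤
  -- (S + φ_RS) / 2`.
  have h1 : ∀ q : ℝ≥0, SpikedWigner.rsPotential P lam q ≤ (S + SpikedWigner.rsFormula P lam) / 2 := by
    intro q
    have h2 : 2 * SpikedWigner.rsPotential P lam q - SpikedWigner.rsFormula P lam
        ≤ ⨅ q' : ℝ≥0, SpikedWigner.fBar P lam q q' := by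
      refine le_ciInf fun q' => ?_
      have h3 := SpikedWigner.two_mul_psi_sub_psi_le_psiBar hP
        (mul_nonneg hlam q.coe_nonneg) (mul_nonneg hlam q'.coe_nonneg)
      have h4 : SpikedWigner.rsPotential P lam q' ≤ SpikedWigner.rsFormula P lam := le_ciSup hF q'
      simp only [SpikedWigner.fBar, SpikedWigner.rsPotential] at h4 ⊢
      linarith
    have h5 := h2.trans (le_ciSup hS (q : ℝ))
    linarith
  have h6 : SpikedWigner.rsFormula P lam ≤ (S + SpikedWigner.rsFormula P lam) / 2 := ciSup_le h1
  linarith
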